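/- Let $N\ge 2$, let $0=t_0<t_1<\dots<t_N=1$, put $\sigma_t=\sqrt{(1-t)^2+t^2}$, and let $\mu^\star_{t_i}=\mathcal N(0,\sigma_{t_i}^2)$ for $i=0,\dots,N$. Let $\mathcal P_2(\mathbb R)$ be the space of Borel probability measures on $\mathbb R$ with finite second moment. It carries the geometry of its isometric embedding into $L^2[0,1]$, which sends $\mu$ to its quantile function $F_\mu^\dagger$. An E-spline is a curve $(\mu_t)_{t\in[0,1]}$ in $\mathcal P_2(\mathbb R)$ with $\mu_{t_i}=\mu^\star_{t_i}$ for all $i$ that minimizes $\int_0^1\|\partial_t^2F_{\mu_t}^\dagger\|_{L^2[0,1]}^2\,dt$ among all such curves. A P-spline is a real-valued stochastic process $(X_t)_{t\in[0,1]}$, with paths in $W^{2,2}([0,1])$ almost surely and $X_{t_i}\sim\mu^\star_{t_i}$ for all $i$, that minimizes $\int_0^1\mathbb E[|\ddot X_t|^2]\,dt$ among all such processes. In both problems the cost of a curve or path without a square integrable second (weak) derivative is $+\infty$. Then: 1. There is exactly one E-spline. It is $\mu^{\rm E}_t=\mathcal N(0,\gamma(t)^2)$, where $\gamma$ is the natural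 cubic spline with knots $t_i$ and values $\gamma(t_i)=\sigma_{t_i}$, and $\gamma>0$ on $[0,1]$. (A natural cubic spline is $C^2$ on $[0,1]$, a polynomial of degree at most $3$ on each $[t_{i},t_{i+1}]$, and has $\gamma''(0)=\gamma''(1)=0$.) 2. There is a P-spline whose law at each time $t\in[0,1]$ is $\mathcal N(0,(1-t)^2+t^2)$. For every P-spline and every $t\in[0,1]$, $X_t$ is square integrable with mean $0$ and standard deviation $\sqrt{(1-t)^2+t^2}$. 3. The measures interpolated by the E-spline and by any P-spline do not coincide: for every P-spline $(X_t)$ there is a $t\in[0,1]$ such that $\mu^{\rm E}_t$ is not the law of $X_t$. -/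

import Mathlib

open MeasureTheory ProbabilityTheory Set
open scoped ENNReal NNReal

universe u

noncomputable section

namespace WassersteinSplines

/-! ### The curvature energy of a curve in a Hilbert space -/

/-- `a` is the (weak) second time derivative, square integrable on `[0,1]`, of the curve `γ`:
there is a velocity `v` with `γ t = γ 0 + ∫₀ᵗ v` and `v t = v 0 + ∫₀ᵗ a` for `t ∈ [0,1]`.
Thus `γ` restricted to `[0,1]` is (the continuous version of) an element of the Sobolev space
`W^{2,2}([0,1]; H)`.  Only the values of `γ` on `[0,1]` matter. -/
def HasL2Acceleration {H : Type*} [NormedAddCommGroup H] [InnerProductSpace ℝ H]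
    [CompleteSpace H] (γ a : ℝ → H) : Prop :=
  MemLp a 2 (volume.restrict (Icc (0 : ℝ) 1)) ∧
    ∃ v : ℝ → H, ∀ t ∈ Icc (0 : ℝ) 1,
      v t = v 0 + ∫ s in (0 : ℝ)..t, a s ∧ γ t = γ 0 + ∫ s in (0 : ℝ)..t, v s

/-- The energy `∫₀¹ ‖γ̈ t‖² dt ∈ [0, ∞]`.  The acceleration is unique up to null sets, so the
infimum is over a single value; it is `∞` when `γ` has no square integrable acceleration. -/
def splineEnergy {H : Type*} [NormedAddCommGroup H] [InnerProductSpace ℝ H]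
    [CompleteSpace H] (γ : ℝ → H) : ℝ≥0∞ :=
  ⨅ (a : ℝ → H) (_ : HasL2Acceleration γ a), ∫⁻ t in Icc (0 : ℝ) 1, ‖a t‖ₑ ^ 2

/-! ### Natural cubic splines -/

/-- `γ` is the natural cubic spline on `[0,1]` with knots `τ` and values `x`: it interpolates,
is `C²` on `[0,1]`, is a polynomial of degree at most three between consecutive knots, and has
zero second derivative at both ends. -/
structure IsNaturalCubicSpline {N : ℕ} (τ x : Fin (N + 1) → ℝ) (γ : ℝ → ℝ) : Prop where
  interpolates : ∀ i, γ (τ i) = x i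
  contDiffOn : ContDiffOn ℝ 2 γ (Icc 0 1)
  piecewise_cubic : ∀ i : Fin N, ∃ p : Polynomial ℝ, p.natDegree ≤ 3 ∧
    ∀ t ∈ Icc (τ i.castSucc) (τ i.succ), γ t = p.eval t
  second_deriv_zero : iteratedDerivWithin 2 γ (Icc 0 1) 0 = 0
  second_deriv_one : iteratedDerivWithin 2 γ (Icc 0 1) 1 = 0

/-! ### The Wasserstein space `𝒫₂(ℝ)` and its embedding in `L²[0,1]` -/

/-- `𝒫₂(ℝ)`: the Borel probability measures on `ℝ` with finite second moment. -/
def P2 : Type :=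
  {μ : Measure ℝ // IsProbabilityMeasure μ ∧ MemLp (id : ℝ → ℝ) 2 μ}

/-- The quantile function `u ↦ inf {x | u ≤ F_μ x}`, used for `0 < u < 1`. -/
def quantile (μ : Measure ℝ) (u : ℝ) : ℝ :=
  sInf {x : ℝ | u ≤ cdf μ x}

/-- The uniform probability measure on the unit interval. -/
def unif : Measure ℝ := volume.restrict (Ioo 0 1)

theorem quantile_le_iff (μ : Measure ℝ) {u : ℝ} (hu : u ∈ Ioo (0 : ℝ) 1) (x : ℝ) :
    quantile μ u ≤ x ↔ u ≤ cdf μ x := by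
  have hne : {x : ℝ | u ≤ cdf μ x}.Nonempty := by
    obtain ⟨y, hy⟩ := ((tendsto_cdf_atTop μ).eventually (lt_mem_nhds hu.2)).exists
    exact ⟨y, hy.le⟩
  have hbdd : BddBelow {x : ℝ | u ≤ cdf μ x} := by
    obtain ⟨y, hy⟩ := ((tendsto_cdf_atBot μ).eventually (gt_mem_nhds hu.1)).exists
    refine ⟨y, fun z hz => ?_⟩
    by_contra hlt
    exact absurd (hz.trans (monotone_cdf μ (not_le.mp hlt).le)) (not_le.mpr hy)
  constructor
  · intro h
    have hright : ∀ y, x < y → u ≤ cdf μ y := by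
      intro y hy
      obtain ⟨z, hz, hzy⟩ := (csInf_lt_iff hbdd hne).mp (lt_of_le_of_lt h hy)
      exact le_trans hz (monotone_cdf μ hzy.le)
    have hc : Filter.Tendsto (cdf μ) (nhdsWithin x (Ioi x)) (nhds (cdf μ x)) :=
      ((cdf μ).right_continuous x).mono_left (nhdsWithin_mono x Ioi_subset_Ici_self)
    refine ge_of_tendsto hc ?_
    filter_upwards [self_mem_nhdsWithin] with y hy
    exact hright y hy
  · intro h
    exact csInf_le hbdd h

theorem aemeasurable_quantile (μ : Measure ℝ) : AEMeasurable (quantile μ) unif := by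
  refine aemeasurable_restrict_of_monotoneOn measurableSet_Ioo ?_
  intro a ha b hb hab
  exact (quantile_le_iff μ ha _).mpr (hab.trans ((quantile_le_iff μ hb _).mp le_rfl))

instance : IsProbabilityMeasure unif := ⟨by simp [unif]⟩

/-- The quantile function transports the uniform measure to `μ`. -/
theorem map_quantile (μ : Measure ℝ) [IsProbabilityMeasure μ] :
    unif.map (quantile μ) = μ := by
  have : IsProbabilityMeasure (unif.map (quantile μ)) :=
    Measure.isProbabilityMeasure_map (aemeasurable_quantile μ)
  refine Measure.ext_of_Iic _ _ fun x => ?_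
  rw [Measure.map_apply_of_aemeasurable (aemeasurable_quantile μ) measurableSet_Iic,
    ← ofReal_cdf μ x]
  have h1 : unif (quantile μ ⁻¹' Iic x) = unif (Iic (cdf μ x)) := by
    refine measure_congr ?_
    have : ∀ᵐ u ∂unif, u ∈ Ioo (0 : ℝ) 1 := ae_restrict_mem measurableSet_Ioo
    filter_upwards [this] with u hu
    exact propext (quantile_le_iff μ hu x)
  rw [h1, unif, restrict_Ioo_eq_restrict_Ioc, Measure.restrict_apply measurableSet_Iic,
    inter_comm, Ioc_inter_Iic, Real.volume_Ioc, inf_eq_right.mpr (cdf_le_one μ x), sub_zero]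

theorem memLp_quantile (μ : P2) : MemLp (quantile μ.1) 2 unif := by
  have := μ.2.1
  have h : MemLp (id : ℝ → ℝ) 2 (unif.map (quantile μ.1)) := by
    rw [map_quantile]; exact μ.2.2
  exact (memLp_map_measure_iff h.1 (aemeasurable_quantile μ.1)).mp h

/-- The isometric embedding `𝒫₂(ℝ) → L²[0,1]` sending a measure to its quantile function. -/
def quantileL2 (μ : P2) : Lp ℝ 2 unif :=
  (memLp_quantile μ).toLp (quantile μ.1)

/-! ### E-splines -/

/-- The E-spline cost of a curve in `𝒫₂(ℝ)`: the integral over `[0,1]` of the squared norm of its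
acceleration, for the geometry given by the isometric embedding `𝒫₂(ℝ) → L²[0,1]`. -/
def eCost (μ : ℝ → P2) : ℝ≥0∞ :=
  splineEnergy fun t => quantileL2 (μ t)

/-- `μ` is an E-spline through the measures `ν i` at the times `τ i`: it interpolates the data, and
has least cost among all curves in `𝒫₂(ℝ)` that do. -/
def IsESpline {N : ℕ} (τ : Fin (N + 1) → ℝ) (ν : Fin (N + 1) → Measure ℝ) (μ : ℝ → P2) : Prop :=
  (∀ i, (μ (τ i)).1 = ν i) ∧
    ∀ μ' : ℝ → P2, (∀ i, (μ' (τ i)).1 = ν i) → eCost μ ≤ eCost μ'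

/-! ### P-splines -/

/-- `X` is a real process on `(Ω, P)` with time set `[0,1]`, almost all of whose paths have a
square integrable acceleration, and whose marginal law at time `τ i` is `ν i`. -/
structure IsInterpolatingProcess {N : ℕ} (τ : Fin (N + 1) → ℝ) (ν : Fin (N + 1) → Measure ℝ)
    {Ω : Type u} [MeasurableSpace Ω] (P : Measure Ω) (X : ℝ → Ω → ℝ) : Prop where
  measurable : ∀ t ∈ Icc (0 : ℝ) 1, Measurable (X t)
  acceleration : ∀ᵐ ω ∂P, ∃ a : ℝ → ℝ, HasL2Acceleration (fun t => X t ω) a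
  law : ∀ i, P.map (X (τ i)) = ν i

/-- The P-spline cost: the expected energy `∫₀¹ |Ẍ_t|² dt` of the paths. -/
def pCost {Ω : Type u} [MeasurableSpace Ω] (P : Measure Ω) (X : ℝ → Ω → ℝ) : ℝ≥0∞ :=
  ∫⁻ ω, splineEnergy (fun t => X t ω) ∂P

/-- `X` is a P-spline through the measures `ν i` at the times `τ i`: it has least cost among all
interpolating processes, on any probability space. -/
def IsPSpline {N : ℕ} (τ : Fin (N + 1) → ℝ) (ν : Fin (N + 1) → Measure ℝ)
    {Ω : Type u} [MeasurableSpace Ω] (P : Measure Ω) (X : ℝ → Ω → ℝ) : Prop :=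
  IsInterpolatingProcess τ ν P X ∧
    ∀ (Ω' : Type u) [MeasurableSpace Ω'] (P' : Measure Ω') [IsProbabilityMeasure P']
      (X' : ℝ → Ω' → ℝ), IsInterpolatingProcess τ ν P' X' → pCost P X ≤ pCost P' X'

end WassersteinSplines

end

namespace WassersteinSplines

/-! Both problems reduce to one estimate in a Hilbert space. Let `k s = ∑ i, c i * max (s - τ i) 0`
with `∑ c i = ∑ c i * τ i = 0`. Integrating by parts twice, the integral of `k` against an
acceleration is `∑ c i • γ (τ i)` (`HasL2Acceleration.integral_kernel`). A curve vanishing at the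
knots therefore has acceleration orthogonal to `k • Z`, so Pythagoras makes the spline with
acceleration `k • Z` minimal, with excess at least `16 ‖γ' t - γ t‖ ^ 2`
(`energy_add_sq_norm_sub_le_splineEnergy`). This gap gives uniqueness at every time.

For E-splines, the quantile function of `N(0, x²)` is `x • Z` for `x > 0`, where `Z` is that of
`N(0, 1)`. The data lie on a ray, so the minimizer in all of `L²` is the scalar spline times `Z`. It
comes from a curve of measures because the scalar spline is positive (`cubicSpline_pos`): the
function `√((1 - t)² + t²)` interpolates the same values with energy at most `8`, too little to go
from `1` to `0` and back.

For P-splines, `(1 - t) A + t B` with `A`, `B` independent standard Gaussians has the prescribed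
laws and costs nothing. Every P-spline thus has zero cost and equals its chord almost surely at each
time. The variance at an interior knot forces the endpoints to be uncorrelated, which fixes the mean
and variance everywhere (`IsPSpline.moments`).

If the two interpolations agreed, the square of a polynomial would be `(1 - t)² + t²`, which is not
a square in `ℝ[X]`. -/

/-- The velocity is determined by its initial value and the acceleration, hence is continuous. -/
theorem continuousOn_velocity {E : Type*} [NormedAddCommGroup E] [NormedSpace ℝ E]
    {a v : ℝ → E} (ha : IntervalIntegrable a volume 0 1)
    (hv : ∀ t ∈ Icc (0 : ℝ) 1, v t = v 0 + ∫ s in (0 : ℝ)..t, a s) :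
    ContinuousOn v (Icc 0 1) := by
  have h : ContinuousOn (fun t => ∫ s in (0 : ℝ)..t, a s) (uIcc 0 1) :=
    intervalIntegral.continuousOn_primitive_interval (by
      rw [uIcc_of_le zero_le_one]
      exact (intervalIntegrable_iff_integrableOn_Icc_of_le zero_le_one).1 ha)
  rw [uIcc_of_le zero_le_one] at h
  exact (continuousOn_const.add h).congr hv

theorem lintegral_enorm_sq_eq_ofReal {E α : Type*} [NormedAddCommGroup E] [MeasurableSpace α]
    {μ : Measure α} {f : α → E} (hf : MemLp f 2 μ) :
    ∫⁻ t, ‖f t‖ₑ ^ 2 ∂μ = ENNReal.ofReal (∫ t, ‖f t‖ ^ 2 ∂μ) := by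
  rw [ofReal_integral_eq_lintegral_ofReal (hf.integrable_norm_pow two_ne_zero)
    (ae_of_all _ fun t => by positivity)]
  refine lintegral_congr fun t => ?_
  rw [ENNReal.ofReal_pow (norm_nonneg _), ofReal_norm]

/-! ### Energy estimates for curves in a Hilbert space -/

section Acceleration

variable {H : Type*} [NormedAddCommGroup H] [InnerProductSpace ℝ H] [CompleteSpace H]
  {γ γ' a b : ℝ → H}

theorem HasL2Acceleration.integrable (h : HasL2Acceleration γ a) :
    Integrable a (volume.restrict (Icc (0 : ℝ) 1)) :=
  h.1.integrable one_le_two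

theorem HasL2Acceleration.intervalIntegrable (h : HasL2Acceleration γ a) :
    IntervalIntegrable a volume 0 1 := by
  rw [intervalIntegrable_iff_integrableOn_Icc_of_le zero_le_one]
  exact h.integrable

theorem HasL2Acceleration.congr (h : HasL2Acceleration γ a)
    (h' : ∀ t ∈ Icc (0 : ℝ) 1, γ' t = γ t) : HasL2Acceleration γ' a := by
  obtain ⟨ma, v, hv⟩ := h
  refine ⟨ma, v, fun t ht => ⟨(hv t ht).1, ?_⟩⟩
  rw [h' t ht, h' 0 (by simp), (hv t ht).2]

theorem HasL2Acceleration.sub (h : HasL2Acceleration γ a) (h' : HasL2Acceleration γ' b) :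
    HasL2Acceleration (fun t => γ t - γ' t) (fun t => a t - b t) := by
  have ha := h.intervalIntegrable
  have hb := h'.intervalIntegrable
  obtain ⟨ma, v, hv⟩ := h
  obtain ⟨mb, w, hw⟩ := h'
  refine ⟨ma.sub mb, fun t => v t - w t, fun t ht => ?_⟩
  have hsub : uIcc 0 t ⊆ uIcc (0 : ℝ) 1 := by
    rw [uIcc_of_le ht.1, uIcc_of_le zero_le_one]; exact Icc_subset_Icc_right ht.2
  have iv : IntervalIntegrable v volume 0 t :=
    ((continuousOn_velocity ha fun t ht => (hv t ht).1).mono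
      (by rw [uIcc_of_le ht.1]; exact Icc_subset_Icc_right ht.2)).intervalIntegrable
  have iw : IntervalIntegrable w volume 0 t :=
    ((continuousOn_velocity hb fun t ht => (hw t ht).1).mono
      (by rw [uIcc_of_le ht.1]; exact Icc_subset_Icc_right ht.2)).intervalIntegrable
  constructor <;> dsimp only
  · rw [intervalIntegral.integral_sub (ha.mono_set hsub) (hb.mono_set hsub), (hv t ht).1,
      (hw t ht).1]
    abel
  · rw [intervalIntegral.integral_sub iv iw, (hv t ht).2, (hw t ht).2]
    abel

/-- A curve which is twice continuously differentiable has its classical acceleration. -/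
theorem HasL2Acceleration.of_hasDerivAt {v : ℝ → H} (hγ : ∀ t, HasDerivAt γ (v t) t)
    (hv : ∀ t, HasDerivAt v (a t) t) (ha : Continuous a) : HasL2Acceleration γ a := by
  have hvc : Continuous v := continuous_iff_continuousAt.2 fun t => (hv t).continuousAt
  refine ⟨?_, v, fun t _ => ⟨?_, ?_⟩⟩
  · have := (memLp_two_iff_integrable_sq_norm (μ := volume.restrict (Icc (0 : ℝ) 1))
      ha.aestronglyMeasurable.restrict).2
    exact this (ha.norm.pow 2).continuousOn.integrableOn_Icc
  · rw [intervalIntegral.integral_eq_sub_of_hasDerivAt (fun s _ => hv s)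
      (ha.intervalIntegrable _ _)]
    abel
  · rw [intervalIntegral.integral_eq_sub_of_hasDerivAt (fun s _ => hγ s)
      (hvc.intervalIntegrable _ _)]
    abel

theorem contDiff_two_of_hasDerivAt {f v s : ℝ → ℝ} (hf : ∀ t, HasDerivAt f (v t) t)
    (hv : ∀ t, HasDerivAt v (s t) t) (hs : Continuous s) :
    ContDiff ℝ 2 f ∧ iteratedDeriv 2 f = s := by
  have h1 : deriv f = v := funext fun t => (hf t).deriv
  have h2 : deriv v = s := funext fun t => (hv t).deriv
  constructor
  · have : ContDiff ℝ (1 + 1) f := by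
      rw [contDiff_succ_iff_deriv]
      refine ⟨fun t => (hf t).differentiableAt, by simp, ?_⟩
      rw [h1, contDiff_one_iff_deriv, h2]
      exact ⟨fun t => (hv t).differentiableAt, hs⟩
    simpa [one_add_one_eq_two] using this
  · rw [iteratedDeriv_succ, iteratedDeriv_one, h1, h2]

/-- Fubini on the triangle `τ < t < s ≤ 1`. -/
theorem integral_integral_triangle (ha : IntervalIntegrable a volume 0 1) {τ : ℝ}
    (hτ : τ ∈ Icc (0 : ℝ) 1) :
    ∫ t in τ..1, ∫ s in t..1, a s = ∫ s in (0 : ℝ)..1, max (s - τ) 0 • a s := by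
  rw [intervalIntegrable_iff_integrableOn_Ioc_of_le zero_le_one] at ha
  set μ := volume.restrict (Ioc (0 : ℝ) 1) with hμ
  have hS : MeasurableSet {p : ℝ × ℝ | τ < p.1 ∧ p.1 < p.2} :=
    (measurableSet_lt measurable_const measurable_fst).inter
      (measurableSet_lt measurable_fst measurable_snd)
  have hint : Integrable ({p : ℝ × ℝ | τ < p.1 ∧ p.1 < p.2}.indicator fun p => a p.2)
      (μ.prod μ) := (Integrable.comp_snd ha μ).indicator hS
  have key := integral_integral_swap (f := fun t s =>
    ({p : ℝ × ℝ | τ < p.1 ∧ p.1 < p.2}.indicator fun p => a p.2) (t, s)) hint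
  have hL : ∀ t ∈ Ioc (0 : ℝ) 1, ∫ s, ({p : ℝ × ℝ | τ < p.1 ∧ p.1 < p.2}.indicator
      fun p => a p.2) (t, s) ∂μ = (Ioc τ 1).indicator (fun t => ∫ s in t..1, a s) t := by
    intro t ht
    by_cases h : τ < t
    · rw [indicator_of_mem (show t ∈ Ioc τ 1 from ⟨h, ht.2⟩),
        intervalIntegral.integral_of_le ht.2]
      have : (fun s => ({p : ℝ × ℝ | τ < p.1 ∧ p.1 < p.2}.indicator
          fun p => a p.2) (t, s)) = (Ioi t).indicator a := by
        ext s
        simp [indicator, h]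
      rw [this, integral_indicator measurableSet_Ioi, hμ,
        Measure.restrict_restrict measurableSet_Ioi, inter_comm, Ioc_inter_Ioi,
        max_eq_right ht.1.le]
    · rw [indicator_of_notMem (fun h' => h h'.1)]
      simp [indicator, h]
  have hR : ∀ s ∈ Ioc (0 : ℝ) 1, ∫ t, ({p : ℝ × ℝ | τ < p.1 ∧ p.1 < p.2}.indicator
      fun p => a p.2) (t, s) ∂μ = max (s - τ) 0 • a s := by
    intro s hs
    have : (fun t => ({p : ℝ × ℝ | τ < p.1 ∧ p.1 < p.2}.indicator
        fun p => a p.2) (t, s)) = (Ioo τ s).indicator fun _ => a s := by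
      ext t
      simp [indicator]
    rw [this, integral_indicator_const _ measurableSet_Ioo, hμ, Measure.real,
      Measure.restrict_apply measurableSet_Ioo, inter_eq_left.2, Real.volume_Ioo,
      ENNReal.toReal_ofReal']
    exact fun t ht => ⟨hτ.1.trans_lt ht.1, ht.2.le.trans hs.2⟩
  rw [hμ, setIntegral_congr_fun measurableSet_Ioc hL, setIntegral_congr_fun measurableSet_Ioc hR,
    setIntegral_indicator measurableSet_Ioc, inter_eq_right.2 (Ioc_subset_Ioc_left hτ.1)] at key
  rw [intervalIntegral.integral_of_le hτ.2, intervalIntegral.integral_of_le zero_le_one, key]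

/-- Integrating by parts twice against the kernel `(s - τ)₊`. -/
theorem HasL2Acceleration.exists_integral_posPart (h : HasL2Acceleration γ a) :
    ∃ w : H, ∀ τ ∈ Icc (0 : ℝ) 1,
      ∫ s in (0 : ℝ)..1, max (s - τ) 0 • a s = (1 - τ) • w - γ 1 + γ τ := by
  have ha := h.intervalIntegrable
  obtain ⟨-, v, hv⟩ := h
  have hvc := continuousOn_velocity ha fun t ht => (hv t ht).1
  -- The vector is the terminal velocity: the inner integral over `[t, 1]` is `v 1 - v t`, and
  -- integrating this over `[τ, 1]` gives the right-hand side.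
  refine ⟨v 1, fun τ hτ => ?_⟩
  have h1 : (1 : ℝ) ∈ Icc (0 : ℝ) 1 := by simp
  have hvi : ∀ x ∈ Icc (0 : ℝ) 1, ∀ y ∈ Icc (0 : ℝ) 1, IntervalIntegrable v volume x y :=
    fun x hx y hy => (hvc.mono (uIcc_subset_Icc hx hy)).intervalIntegrable
  have hai : ∀ x ∈ Icc (0 : ℝ) 1, ∀ y ∈ Icc (0 : ℝ) 1, IntervalIntegrable a volume x y :=
    fun x hx y hy => ha.mono_set (by
      rw [uIcc_of_le zero_le_one]; exact uIcc_subset_Icc hx hy)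
  have h0 : (0 : ℝ) ∈ Icc (0 : ℝ) 1 := by simp
  rw [← integral_integral_triangle ha hτ]
  have hin : EqOn (fun t => ∫ s in t..1, a s) (fun t => v 1 - v t) (uIcc τ 1) := by
    intro t ht
    have ht' : t ∈ Icc (0 : ℝ) 1 := uIcc_subset_Icc hτ h1 ht
    have := intervalIntegral.integral_add_adjacent_intervals (hai 0 h0 t ht') (hai t ht' 1 h1)
    simp only
    rw [(hv 1 h1).1, (hv t ht').1, ← this]
    abel
  rw [intervalIntegral.integral_congr hin, intervalIntegral.integral_sub
    intervalIntegrable_const (hvi τ hτ 1 h1), intervalIntegral.integral_const]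
  have := intervalIntegral.integral_add_adjacent_intervals (hvi 0 h0 τ hτ) (hvi τ hτ 1 h1)
  rw [(hv 1 h1).2, (hv τ hτ).2, ← this]
  abel

/-- The second-difference functionals are represented by integration of the acceleration
against piecewise affine kernels. -/
theorem HasL2Acceleration.integral_kernel {ι : Type*} [Fintype ι] (h : HasL2Acceleration γ a)
    {τ c : ι → ℝ} (hτ : ∀ i, τ i ∈ Icc (0 : ℝ) 1) (hc : ∑ i, c i = 0)
    (hcτ : ∑ i, c i * τ i = 0) :
    ∫ s in Icc (0 : ℝ) 1, (∑ i, c i * max (s - τ i) 0) • a s = ∑ i, c i • γ (τ i) := by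
  obtain ⟨w, hw⟩ := h.exists_integral_posPart
  have hi : ∀ i, IntervalIntegrable (fun s => c i • max (s - τ i) 0 • a s) volume 0 1 :=
    fun i => (h.intervalIntegrable.continuousOn_smul (by fun_prop)).smul (c i)
  rw [integral_Icc_eq_integral_Ioc, ← intervalIntegral.integral_of_le zero_le_one]
  simp_rw [Finset.sum_smul, mul_smul]
  rw [intervalIntegral.integral_finsetSum fun i _ => hi i]
  simp_rw [intervalIntegral.integral_smul, hw _ (hτ _), smul_add, smul_sub, smul_smul]
  rw [Finset.sum_add_distrib, Finset.sum_sub_distrib, ← Finset.sum_smul, ← Finset.sum_smul, hc]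
  have : ∑ i, c i * (1 - τ i) = 0 := by
    simp_rw [mul_sub, mul_one]; rw [Finset.sum_sub_distrib, hc, hcτ, sub_zero]
  simp [this]

/-- The distance from a curve to its chord is controlled by its acceleration. -/
theorem HasL2Acceleration.sq_norm_sub_chord_le (h : HasL2Acceleration γ a) {t : ℝ}
    (ht : t ∈ Icc (0 : ℝ) 1) :
    16 * ‖γ t - (1 - t) • γ 0 - t • γ 1‖ ^ 2 ≤ ∫ s in Icc (0 : ℝ) 1, ‖a s‖ ^ 2 := by
  -- These weights annihilate affine functions. The kernel is minus the Dirichlet Green's function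
  -- of `[0,1]`: `-(1 - t) s` for `s ≤ t` and `-t (1 - s)` for `s ≥ t`, hence at most `1 / 4` in
  -- absolute value.
  have hk := h.integral_kernel (τ := ![t, 0, 1]) (c := ![1, -(1 - t), -t])
    (by intro i; fin_cases i <;> simp [ht.1, ht.2]) (by simp [Fin.sum_univ_three])
    (by simp [Fin.sum_univ_three])
  have hdev : γ t - (1 - t) • γ 0 - t • γ 1 = ∑ i, (![1, -(1 - t), -t] : Fin 3 → ℝ) i •
      γ ((![t, 0, 1] : Fin 3 → ℝ) i) := by
    simp only [Fin.sum_univ_three, Matrix.cons_val_zero, Matrix.cons_val_one, Matrix.cons_val,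
      one_smul, neg_smul]
    abel
  have hle : ‖γ t - (1 - t) • γ 0 - t • γ 1‖ ≤ ∫ s in Icc (0 : ℝ) 1, 1 / 4 * ‖a s‖ := by
    rw [hdev, ← hk]
    refine norm_integral_le_of_norm_le (h.integrable.norm.const_mul _) ?_
    filter_upwards [ae_restrict_mem measurableSet_Icc] with s hs
    rw [norm_smul]
    refine mul_le_mul_of_nonneg_right ?_ (norm_nonneg _)
    obtain ⟨h0, h1⟩ := ht
    obtain ⟨s0, s1⟩ := hs
    simp only [Fin.sum_univ_three, Matrix.cons_val_zero, Matrix.cons_val_one, Matrix.cons_val,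
      sub_zero, max_eq_left s0, max_eq_right (sub_nonpos.2 s1), mul_zero, add_zero, one_mul]
    rw [Real.norm_eq_abs, abs_le]
    rcases le_total s t with hst | hst
    · rw [max_eq_right (sub_nonpos.2 hst)]
      constructor <;> nlinarith [sq_nonneg (t - 1 / 2), mul_nonneg s0 (sub_nonneg.2 h1)]
    · rw [max_eq_left (sub_nonneg.2 hst)]
      constructor <;> nlinarith [sq_nonneg (t - 1 / 2), mul_nonneg h0 (sub_nonneg.2 s1)]
  -- Jensen's inequality on the probability space `[0,1]`, read off from nonnegativity of the
  -- variance.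
  have hvar : (∫ s in Icc (0 : ℝ) 1, ‖a s‖) ^ 2 ≤ ∫ s in Icc (0 : ℝ) 1, ‖a s‖ ^ 2 := by
    have : IsProbabilityMeasure (volume.restrict (Icc (0 : ℝ) 1)) := ⟨by simp⟩
    have := variance_nonneg (fun s => ‖a s‖) (volume.restrict (Icc (0 : ℝ) 1))
    rw [variance_eq_sub h.1.norm] at this
    simpa using this
  rw [integral_const_mul] at hle
  have := pow_le_pow_left₀ (norm_nonneg _) hle 2
  nlinarith

/-- Stated for the infimum, the chord bound also covers curves without acceleration, so it can be
integrated over paths with no measurable choice of accelerations. -/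
theorem sq_norm_sub_chord_le_splineEnergy {t : ℝ} (ht : t ∈ Icc (0 : ℝ) 1) :
    ENNReal.ofReal (16 * ‖γ t - (1 - t) • γ 0 - t • γ 1‖ ^ 2) ≤ splineEnergy γ := by
  refine le_iInf₂ fun a ha => ?_
  rw [lintegral_enorm_sq_eq_ofReal ha.1]
  exact ENNReal.ofReal_le_ofReal (ha.sq_norm_sub_chord_le ht)

/-- A curve whose acceleration is a natural kernel minimizes the energy among the curves with the
same values at the knots, with a quantitative gap. -/
theorem energy_add_sq_norm_sub_le_splineEnergy {ι : Type*} [Fintype ι] {τ c : ι → ℝ}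
    (hτ : ∀ i, τ i ∈ Icc (0 : ℝ) 1) (h0 : ∃ i, τ i = 0) (h1 : ∃ i, τ i = 1)
    (hc : ∑ i, c i = 0) (hcτ : ∑ i, c i * τ i = 0) {Z : H}
    (hγ : HasL2Acceleration γ fun s => (∑ i, c i * max (s - τ i) 0) • Z)
    (hγ' : ∀ i, γ' (τ i) = γ (τ i)) {t : ℝ} (ht : t ∈ Icc (0 : ℝ) 1) :
    ENNReal.ofReal ((∫ s in Icc (0 : ℝ) 1, ‖(∑ i, c i * max (s - τ i) 0) • Z‖ ^ 2) +
      16 * ‖γ' t - γ t‖ ^ 2) ≤ splineEnergy γ' := by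
  refine le_iInf₂ fun a ha => ?_
  rw [lintegral_enorm_sq_eq_ofReal ha.1]
  refine ENNReal.ofReal_le_ofReal ?_
  set k : ℝ → ℝ := fun s => ∑ i, c i * max (s - τ i) 0 with hk
  have hW := ha.sub hγ
  have hchord := hW.sq_norm_sub_chord_le ht
  obtain ⟨i0, hi0⟩ := h0
  obtain ⟨i1, hi1⟩ := h1
  have e0 : γ' 0 - γ 0 = 0 := by rw [← hi0, hγ', sub_self]
  have e1 : γ' 1 - γ 1 = 0 := by rw [← hi1, hγ', sub_self]
  rw [e0, e1, smul_zero, smul_zero, sub_zero, sub_zero] at hchord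
  have hkc : Continuous k := by fun_prop
  have hki : Integrable (fun s => k s • (a s - k s • Z)) (volume.restrict (Icc (0 : ℝ) 1)) := by
    have := hW.intervalIntegrable.continuousOn_smul hkc.continuousOn
    rwa [intervalIntegrable_iff_integrableOn_Icc_of_le zero_le_one] at this
  -- Orthogonality: the integral is a combination of values of `γ' - γ` at the knots, all of which
  -- vanish.
  have hcross : ∫ s in Icc (0 : ℝ) 1, inner ℝ Z (k s • (a s - k s • Z)) = 0 := by
    rw [integral_inner hki, hW.integral_kernel hτ hc hcτ]
    simp [hγ']
  have hexp : ∀ s, ‖a s‖ ^ 2 = ‖k s • Z‖ ^ 2 + 2 * inner ℝ Z (k s • (a s - k s • Z)) +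
      ‖a s - k s • Z‖ ^ 2 := by
    intro s
    conv_lhs => rw [← add_sub_cancel (k s • Z) (a s), norm_add_sq_real]
    rw [real_inner_smul_left, real_inner_smul_right]
  have i1 : Integrable (fun s => ‖k s • Z‖ ^ 2) (volume.restrict (Icc (0 : ℝ) 1)) :=
    hγ.1.integrable_norm_pow'
  have i3 : Integrable (fun s => ‖a s - k s • Z‖ ^ 2) (volume.restrict (Icc (0 : ℝ) 1)) :=
    hW.1.integrable_norm_pow'
  have i2 : Integrable (fun s => 2 * inner ℝ Z (k s • (a s - k s • Z)))
      (volume.restrict (Icc (0 : ℝ) 1)) := (hki.const_inner Z).const_mul 2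
  simp_rw [hexp]
  rw [integral_add (f := fun s => ‖k s • Z‖ ^ 2 + 2 * inner ℝ Z (k s • (a s - k s • Z)))
    (i1.add i2) i3, integral_add i1 i2, integral_const_mul, hcross]
  linarith

end Acceleration

/-! ### Natural cubic splines in the truncated power basis -/

section NaturalSplines

theorem hasDerivAt_posPart_pow (n : ℕ) (τ t : ℝ) :
    HasDerivAt (fun t => max (t - τ) 0 ^ (n + 2)) ((n + 2) * max (t - τ) 0 ^ (n + 1)) t := by
  have hp : HasDerivAt (fun t => (t - τ) ^ (n + 2)) ((n + 2) * (t - τ) ^ (n + 1)) t := by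
    simpa using ((hasDerivAt_id t).sub_const τ).fun_pow (n + 2)
  rcases lt_trichotomy t τ with h | h | h
  · rw [max_eq_right (by linarith), zero_pow n.succ_ne_zero, mul_zero]
    refine (hasDerivAt_const t (0 : ℝ)).congr_of_eventuallyEq ?_
    filter_upwards [Iio_mem_nhds h] with s hs
    rw [max_eq_right (by simpa using le_of_lt hs), zero_pow (by lia)]
  · subst h
    simp only [sub_self, max_self, zero_pow n.succ_ne_zero, mul_zero] at hp ⊢
    -- At the knot the truncated power is dominated by the full power, whose derivative there is
    -- zero.
    rw [hasDerivAt_iff_isLittleO_nhds_zero] at hp ⊢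
    refine (Asymptotics.IsBigO.of_bound' (.of_forall fun h => ?_)).trans_isLittleO hp
    simp only [add_sub_cancel_left, sub_self, max_self, smul_zero, sub_zero, norm_pow,
      ne_eq, Nat.add_eq_zero_iff, OfNat.ofNat_ne_zero, and_false, not_false_eq_true, zero_pow]
    refine pow_le_pow_left₀ (norm_nonneg _) ?_ _
    rcases le_total h 0 with h0 | h0
    · rw [max_eq_right h0, norm_zero]
      exact norm_nonneg h
    · rw [max_eq_left h0]
  · rw [max_eq_left (by linarith)]
    refine hp.congr_of_eventuallyEq ?_
    filter_upwards [Ioi_mem_nhds h] with s hs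
    rw [max_eq_left (by simpa using le_of_lt hs)]

variable {ι : Type*} [Fintype ι]

/-- The function with acceleration `∑ i, c i (t - τ i)₊` that is `α + β t` to the left of all
knots. -/
noncomputable def cubicSpline (τ c : ι → ℝ) (α β t : ℝ) : ℝ :=
  α + β * t + ∑ i, c i * (max (t - τ i) 0 ^ 3 / 6)

theorem hasDerivAt_cubicSpline (τ c : ι → ℝ) (α β t : ℝ) :
    HasDerivAt (cubicSpline τ c α β) (β + ∑ i, c i * (max (t - τ i) 0 ^ 2 / 2)) t := by
  have h : ∀ i, HasDerivAt (fun t => c i * (max (t - τ i) 0 ^ 3 / 6))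
      (c i * (max (t - τ i) 0 ^ 2 / 2)) t := fun i => by
    refine (((hasDerivAt_posPart_pow 1 (τ i) t).div_const 6).const_mul (c i)).congr_deriv ?_
    push_cast; ring
  have := (((hasDerivAt_id t).const_mul β).const_add α).add
    (HasDerivAt.fun_sum fun i (_ : i ∈ Finset.univ) => h i)
  exact this.congr_deriv (by simp)

theorem hasDerivAt_deriv_cubicSpline (τ c : ι → ℝ) (β t : ℝ) :
    HasDerivAt (fun t => β + ∑ i, c i * (max (t - τ i) 0 ^ 2 / 2))
      (∑ i, c i * max (t - τ i) 0) t := by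
  have h : ∀ i, HasDerivAt (fun t => c i * (max (t - τ i) 0 ^ 2 / 2))
      (c i * max (t - τ i) 0) t := fun i => by
    refine (((hasDerivAt_posPart_pow 0 (τ i) t).div_const 2).const_mul (c i)).congr_deriv ?_
    push_cast; ring
  exact (HasDerivAt.fun_sum fun i (_ : i ∈ Finset.univ) => h i).const_add β

theorem hasL2Acceleration_cubicSpline_smul {H : Type*} [NormedAddCommGroup H]
    [InnerProductSpace ℝ H] [CompleteSpace H] (τ c : ι → ℝ) (α β : ℝ) (Z : H) :
    HasL2Acceleration (fun t => cubicSpline τ c α β t • Z)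
      fun t => (∑ i, c i * max (t - τ i) 0) • Z :=
  .of_hasDerivAt (fun t => (hasDerivAt_cubicSpline τ c α β t).smul_const Z)
    (fun t => (hasDerivAt_deriv_cubicSpline τ c β t).smul_const Z) (by fun_prop)

theorem hasL2Acceleration_affine {H : Type*} [NormedAddCommGroup H] [InnerProductSpace ℝ H]
    [CompleteSpace H] (x y : H) : HasL2Acceleration (fun t => x + t • y) fun _ => 0 := by
  refine .of_hasDerivAt (v := fun _ => y) (fun t => ?_) (fun t => hasDerivAt_const t y)
    continuous_const
  simpa using ((hasDerivAt_id t).smul_const y).const_add x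

theorem splineEnergy_affine {H : Type*} [NormedAddCommGroup H] [InnerProductSpace ℝ H]
    [CompleteSpace H] (x y : H) : splineEnergy (fun t : ℝ => x + t • y) = 0 :=
  le_antisymm ((iInf₂_le _ (hasL2Acceleration_affine x y)).trans (by simp)) zero_le

variable {N : ℕ} {τ : Fin (N + 1) → ℝ}

theorem knot_mem_Icc (hτ : StrictMono τ) (hτ0 : τ 0 = 0) (hτ1 : τ (Fin.last N) = 1)
    (i : Fin (N + 1)) : τ i ∈ Icc (0 : ℝ) 1 :=
  ⟨hτ0 ▸ hτ.monotone (Fin.zero_le i), hτ1 ▸ hτ.monotone (Fin.le_last i)⟩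

/-- A piecewise affine kernel which vanishes on `[0,1]` has no kinks before the last knot. -/
theorem eq_zero_of_kernel_eq_zero (hτ : StrictMono τ) (c : Fin (N + 1) → ℝ)
    (h : ∀ i, ∑ j, c j * max (τ i - τ j) 0 = 0) (hc : ∑ i, c i = 0) : c = 0 := by
  have key : ∀ i : Fin N, c i.castSucc = 0 := by
    intro i
    induction i using WellFoundedLT.induction with
    | _ i ih =>
      have := h i.succ
      -- At the knot after `i`, later knots contribute nothing and earlier coefficients vanish by
      -- induction.
      rw [Finset.sum_eq_single i.castSucc] at this
      · have hlt := hτ i.castSucc_lt_succ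
        rw [max_eq_left (by linarith)] at this
        exact (mul_eq_zero.1 this).resolve_right (by linarith)
      · intro j _ hj
        rcases lt_or_gt_of_ne hj with hj | hj
        · have hjN : (j : ℕ) < N := by have := Fin.lt_def.1 hj; simp at this; lia
          have := ih ⟨j, hjN⟩ (Fin.lt_def.2 (by simpa using Fin.lt_def.1 hj))
          rw [show j = Fin.castSucc ⟨j, hjN⟩ from rfl, this, zero_mul]
        · have : τ i.succ ≤ τ j := hτ.monotone (Fin.castSucc_lt_iff_succ_le.1 hj)
          rw [max_eq_right (by linarith), mul_zero]
      · simp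
  rw [Fin.sum_univ_castSucc] at hc
  simp only [key, Finset.sum_const_zero, zero_add] at hc
  ext i
  exact Fin.lastCases hc key i

/-- Natural cubic splines interpolate arbitrary data. -/
theorem exists_cubicSpline_eq (hτ : StrictMono τ) (hτ0 : τ 0 = 0) (hτ1 : τ (Fin.last N) = 1)
    (x : Fin (N + 1) → ℝ) :
    ∃ (c : Fin (N + 1) → ℝ) (α β : ℝ), ∑ i, c i = 0 ∧ ∑ i, c i * τ i = 0 ∧
      ∀ i, cubicSpline τ c α β (τ i) = x i := by
  -- Interpolation and the two moment conditions form a square linear system, so uniqueness for zero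
  -- data gives existence.
  let T : (Fin (N + 1) → ℝ) × ℝ × ℝ →ₗ[ℝ] (Fin (N + 1) → ℝ) × ℝ × ℝ :=
    { toFun := fun p => (fun i => cubicSpline τ p.1 p.2.1 p.2.2 (τ i), ∑ i, p.1 i,
        ∑ i, p.1 i * τ i)
      map_add' := fun p q => by
        ext i <;> simp [cubicSpline, add_mul, Finset.sum_add_distrib]
        ring
      map_smul' := fun r p => by
        ext i <;> simp [cubicSpline, mul_add, mul_assoc, Finset.mul_sum] }
  have hT : Function.Injective T := by
    rw [← LinearMap.ker_eq_bot, LinearMap.ker_eq_bot']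
    rintro ⟨c, α, β⟩ hp
    have hp1 : ∀ i, cubicSpline τ c α β (τ i) = 0 := congrFun (congrArg Prod.fst hp)
    have hp2 : ∑ i, c i = 0 := congrArg (fun q : (Fin (N + 1) → ℝ) × ℝ × ℝ => q.2.1) hp
    have hp3 : ∑ i, c i * τ i = 0 := congrArg (fun q : (Fin (N + 1) → ℝ) × ℝ × ℝ => q.2.2) hp
    have hacc := hasL2Acceleration_cubicSpline_smul τ c α β (1 : ℝ)
    -- The zero curve interpolates zero data without energy, so the kernel of the spline has zero
    -- `L²` norm.
    have hgap := energy_add_sq_norm_sub_le_splineEnergy (γ' := fun t => 0 + t • (0 : ℝ))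
      (knot_mem_Icc hτ hτ0 hτ1) ⟨0, hτ0⟩ ⟨_, hτ1⟩ hp2 hp3 hacc (by simp [hp1])
      (left_mem_Icc.2 zero_le_one)
    rw [splineEnergy_affine, nonpos_iff_eq_zero, ENNReal.ofReal_eq_zero] at hgap
    have hz : ∫ s in Icc (0 : ℝ) 1, ‖(∑ i, c i * max (s - τ i) 0) • (1 : ℝ)‖ ^ 2 = 0 :=
      le_antisymm (by linarith [sq_nonneg ‖0 + (0 : ℝ) • (0 : ℝ) - cubicSpline τ c α β 0 • (1 : ℝ)‖])
        (integral_nonneg fun s => by positivity)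
    rw [integral_eq_zero_iff_of_nonneg (fun s => by positivity)
      (hacc.1.integrable_norm_pow two_ne_zero)] at hz
    have hk : EqOn (fun s => ‖(∑ i, c i * max (s - τ i) 0) • (1 : ℝ)‖ ^ 2) 0 (Icc 0 1) :=
      Measure.eqOn_Icc_of_ae_eq volume zero_ne_one hz
        (by fun_prop) continuousOn_const
    have hc : c = 0 := eq_zero_of_kernel_eq_zero hτ c
      (fun i => by simpa using hk (knot_mem_Icc hτ hτ0 hτ1 i)) hp2
    have h0 := hp1 0
    have h1 := hp1 (Fin.last N)
    simp only [cubicSpline, hc, hτ0, hτ1, Pi.zero_apply, zero_mul, Finset.sum_const_zero,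
      mul_zero, mul_one, add_zero] at h0 h1
    rw [h0, zero_add] at h1
    rw [hc, h0, h1]
    rfl
  obtain ⟨⟨c, α, β⟩, hp⟩ := LinearMap.surjective_of_injective hT (x, 0, 0)
  exact ⟨c, α, β, congrArg (fun q : (Fin (N + 1) → ℝ) × ℝ × ℝ => q.2.1) hp,
    congrArg (fun q : (Fin (N + 1) → ℝ) × ℝ × ℝ => q.2.2) hp,
    congrFun (congrArg Prod.fst hp)⟩

theorem isNaturalCubicSpline_cubicSpline (hτ : StrictMono τ) (hτ0 : τ 0 = 0)
    (hτ1 : τ (Fin.last N) = 1) {x c : Fin (N + 1) → ℝ} {α β : ℝ} (hc : ∑ i, c i = 0)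
    (hcτ : ∑ i, c i * τ i = 0) (hx : ∀ i, cubicSpline τ c α β (τ i) = x i) :
    IsNaturalCubicSpline τ x (cubicSpline τ c α β) := by
  obtain ⟨hC, hD⟩ := contDiff_two_of_hasDerivAt (hasDerivAt_cubicSpline τ c α β)
    (hasDerivAt_deriv_cubicSpline τ c β) (by fun_prop)
  have hW : ∀ t ∈ Icc (0 : ℝ) 1, iteratedDerivWithin 2 (cubicSpline τ c α β) (Icc 0 1) t =
      ∑ i, c i * max (t - τ i) 0 := fun t ht => by
    rw [iteratedDerivWithin_eq_iteratedDeriv (uniqueDiffOn_Icc zero_lt_one) hC.contDiffAt ht, hD]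
  refine ⟨hx, hC.contDiffOn, fun i => ?_, ?_, ?_⟩
  -- On this interval a truncated cube is the full cube if its knot is at or left of `τ i.castSucc`,
  -- and zero otherwise.
  · refine ⟨Polynomial.C α + Polynomial.C β * Polynomial.X + ∑ j, if j ≤ i.castSucc then
      Polynomial.C (c j / 6) * (Polynomial.X - Polynomial.C (τ j)) ^ 3 else 0, ?_, ?_⟩
    · refine Polynomial.natDegree_add_le_of_degree_le (by compute_degree!)
        (Polynomial.natDegree_sum_le_of_forall_le _ _ fun j _ => ?_)
      split_ifs
      · compute_degree
      · simp
    · intro t ht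
      simp only [cubicSpline, Polynomial.eval_add, Polynomial.eval_C, Polynomial.eval_mul,
        Polynomial.eval_X, Polynomial.eval_finsetSum]
      congr 1
      refine Finset.sum_congr rfl fun j _ => ?_
      split_ifs with hj
      · have := hτ.monotone hj
        rw [max_eq_left (by linarith [ht.1])]
        simp
        ring
      · have := hτ.monotone (Fin.castSucc_lt_iff_succ_le.1 (not_le.1 hj))
        rw [max_eq_right (by linarith [ht.2])]
        simp
  · rw [hW 0 (by simp)]
    refine Finset.sum_eq_zero fun j _ => ?_
    rw [max_eq_right (by linarith [(knot_mem_Icc hτ hτ0 hτ1 j).1]), mul_zero]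
  · rw [hW 1 (by simp)]
    have : ∀ j, c j * max (1 - τ j) 0 = c j - c j * τ j := fun j => by
      rw [max_eq_left (by linarith [(knot_mem_Icc hτ hτ0 hτ1 j).2])]; ring
    simp_rw [this]
    rw [Finset.sum_sub_distrib, hc, hcτ, sub_zero]

/-- In a Hilbert space, natural cubic splines along a line are the unique minimizers of the
energy. -/
theorem exists_splineEnergy_cubicSpline_smul {H : Type*} [NormedAddCommGroup H]
    [InnerProductSpace ℝ H] [CompleteSpace H] (hτ : StrictMono τ) (hτ0 : τ 0 = 0)
    (hτ1 : τ (Fin.last N) = 1) {c : Fin (N + 1) → ℝ} {α β : ℝ} (hc : ∑ i, c i = 0)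
    (hcτ : ∑ i, c i * τ i = 0) (Z : H) :
    ∃ E : ℝ, 0 ≤ E ∧
      (∀ γ : ℝ → H, (∀ t ∈ Icc (0 : ℝ) 1, γ t = cubicSpline τ c α β t • Z) →
        splineEnergy γ ≤ ENNReal.ofReal E) ∧
      ∀ γ : ℝ → H, (∀ i, γ (τ i) = cubicSpline τ c α β (τ i) • Z) → ∀ t ∈ Icc (0 : ℝ) 1,
        ENNReal.ofReal (E + 16 * ‖γ t - cubicSpline τ c α β t • Z‖ ^ 2) ≤ splineEnergy γ := by
  have hacc := hasL2Acceleration_cubicSpline_smul τ c α β Z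
  refine ⟨_, integral_nonneg fun s => by positivity, fun γ h => ?_, fun γ h t ht =>
    energy_add_sq_norm_sub_le_splineEnergy (knot_mem_Icc hτ hτ0 hτ1) ⟨0, hτ0⟩ ⟨_, hτ1⟩ hc hcτ
      hacc h ht⟩
  refine (iInf₂_le _ (hacc.congr h)).trans_eq ?_
  rw [lintegral_enorm_sq_eq_ofReal hacc.1]

/-! ### Energy of `√((1 - t)² + t²)` and positivity of its spline -/

theorem sq_add_sq_pos (t : ℝ) : 0 < (1 - t) ^ 2 + t ^ 2 := by nlinarith [sq_nonneg (2 * t - 1)]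

theorem hasL2Acceleration_sqrt :
    HasL2Acceleration (fun t : ℝ => √((1 - t) ^ 2 + t ^ 2))
      fun t => (√((1 - t) ^ 2 + t ^ 2) ^ 3)⁻¹ := by
  have hpos : ∀ t : ℝ, 0 < √((1 - t) ^ 2 + t ^ 2) := fun t => Real.sqrt_pos.2 (sq_add_sq_pos t)
  have hq : ∀ t : ℝ, HasDerivAt (fun t : ℝ => (1 - t) ^ 2 + t ^ 2) (2 * (2 * t - 1)) t := by
    intro t
    have := (((hasDerivAt_id t).const_sub 1).fun_pow 2).fun_add ((hasDerivAt_id t).fun_pow 2)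
    refine this.congr_deriv ?_
    simp; ring
  have hs : ∀ t : ℝ, HasDerivAt (fun t : ℝ => √((1 - t) ^ 2 + t ^ 2))
      ((2 * t - 1) / √((1 - t) ^ 2 + t ^ 2)) t := by
    intro t
    refine ((hq t).sqrt (sq_add_sq_pos t).ne').congr_deriv ?_
    have := (hpos t).ne'
    field_simp
  refine .of_hasDerivAt hs (fun t => ?_) ?_
  · have hl : HasDerivAt (fun t : ℝ => 2 * t - 1) 2 t := by
      simpa using ((hasDerivAt_id t).const_mul 2).sub_const 1
    refine (hl.fun_div (hs t) (hpos t).ne').congr_deriv ?_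
    have h2 := Real.sq_sqrt (sq_add_sq_pos t).le
    have := (hpos t).ne'
    field_simp
    rw [h2]
    ring
  · exact Continuous.inv₀ (by fun_prop) fun t => pow_ne_zero 3 (hpos t).ne'

/-- The squared acceleration is `((1 - t)² + t²)⁻³`, and the base is at least `1 / 2`. -/
theorem splineEnergy_sqrt_le : splineEnergy (fun t : ℝ => √((1 - t) ^ 2 + t ^ 2)) ≤ 8 := by
  refine (iInf₂_le _ hasL2Acceleration_sqrt).trans ?_
  have : ∀ t : ℝ, ‖(√((1 - t) ^ 2 + t ^ 2) ^ 3)⁻¹‖ₑ ^ 2 ≤ 8 := by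
    intro t
    rw [← ofReal_norm, ← ENNReal.ofReal_pow (norm_nonneg _), norm_inv, norm_pow,
      Real.norm_of_nonneg (Real.sqrt_nonneg _), inv_pow, ← pow_mul, mul_comm 3 2, pow_mul,
      Real.sq_sqrt (sq_add_sq_pos t).le]
    refine ENNReal.ofReal_le_of_le_toReal ?_
    have h : (1 / 2 : ℝ) ≤ (1 - t) ^ 2 + t ^ 2 := by nlinarith [sq_nonneg (2 * t - 1)]
    have := inv_anti₀ (by norm_num) (pow_le_pow_left₀ (by norm_num) h 3)
    norm_num at this ⊢
    exact this
  calc _ ≤ ∫⁻ t in Icc (0 : ℝ) 1, 8 := lintegral_mono this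
    _ = 8 := by simp

/-- The energy of the data `√((1 - t)² + t²)` is too small for its spline to reach zero. -/
theorem cubicSpline_pos (hτ : StrictMono τ) (hτ0 : τ 0 = 0)
    (hτ1 : τ (Fin.last N) = 1) {c : Fin (N + 1) → ℝ} {α β : ℝ} (hc : ∑ i, c i = 0)
    (hcτ : ∑ i, c i * τ i = 0)
    (hx : ∀ i, cubicSpline τ c α β (τ i) = √((1 - τ i) ^ 2 + τ i ^ 2)) {t : ℝ}
    (ht : t ∈ Icc (0 : ℝ) 1) : 0 < cubicSpline τ c α β t := by
  have hacc := hasL2Acceleration_cubicSpline_smul τ c α β (1 : ℝ)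
  have hgap := (energy_add_sq_norm_sub_le_splineEnergy (knot_mem_Icc hτ hτ0 hτ1) ⟨0, hτ0⟩
    ⟨_, hτ1⟩ hc hcτ hacc (γ' := fun t => √((1 - t) ^ 2 + t ^ 2)) (by simp [hx]) ht).trans
    splineEnergy_sqrt_le
  rw [ENNReal.ofReal_le_iff_le_toReal (by simp)] at hgap
  have hchord := hacc.sq_norm_sub_chord_le ht
  have h0 : cubicSpline τ c α β 0 = 1 := by rw [← hτ0, hx, hτ0]; simp
  have h1 : cubicSpline τ c α β 1 = 1 := by rw [← hτ1, hx, hτ1]; simp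
  simp only [h0, h1, smul_eq_mul, mul_one, Real.norm_eq_abs, sq_abs] at hgap hchord
  have e8 : (8 : ℝ≥0∞).toReal = 8 := by simp
  -- The chord is constantly `1`, so the two bounds give `16 (g - 1)² ≤ 8` for the spline value `g`;
  -- this fails when `g ≤ 0`.
  by_contra hneg
  nlinarith [sq_nonneg (√((1 - t) ^ 2 + t ^ 2) - cubicSpline τ c α β t)]

end NaturalSplines

/-! ### Quantile functions of centered Gaussians -/

section Quantiles

theorem P2.ext_of_quantileL2 {μ ν : P2} (h : quantileL2 μ = quantileL2 ν) : μ.1 = ν.1 := by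
  have := μ.2.1
  have := ν.2.1
  have h' : quantile μ.1 =ᵐ[unif] quantile ν.1 :=
    ((memLp_quantile μ).toLp_eq_toLp_iff (memLp_quantile ν)).1 h
  rw [← map_quantile μ.1, ← map_quantile ν.1]
  exact Measure.map_congr h'

theorem quantile_map_const_mul (μ : Measure ℝ) [IsProbabilityMeasure μ] {c : ℝ} (hc : 0 < c)
    {u : ℝ} (hu : u ∈ Ioo (0 : ℝ) 1) : quantile (μ.map (c * ·)) u = c * quantile μ u := by
  have : IsProbabilityMeasure (μ.map (c * ·)) :=
    Measure.isProbabilityMeasure_map (by fun_prop)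
  refine eq_of_forall_ge_iff fun x => ?_
  rw [quantile_le_iff _ hu, ← le_div_iff₀' hc, quantile_le_iff _ hu, cdf_eq_real, cdf_eq_real,
    map_measureReal_apply (by fun_prop) measurableSet_Iic]
  congr! 2
  ext y
  simp [le_div_iff₀' hc]

/-- The Gaussian measures as elements of `𝒫₂(ℝ)`. -/
noncomputable def gaussianP2 (v : ℝ≥0) : P2 :=
  ⟨gaussianReal 0 v, inferInstance, memLp_id_gaussianReal' 2 (by simp)⟩

theorem gaussianReal_sq_eq_map (x : ℝ) :
    gaussianReal 0 (Real.toNNReal (x ^ 2)) = (gaussianReal 0 1).map (x * ·) := by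
  rw [gaussianReal_map_const_mul, mul_zero, mul_one, Real.toNNReal_of_nonneg (sq_nonneg x)]

/-- Positive scaling preserves the order, hence acts linearly on quantile functions; centered
nondegenerate Gaussians thus form an open ray in `L²`. -/
theorem quantileL2_gaussianP2 {x : ℝ} (hx : 0 < x) :
    quantileL2 (gaussianP2 (Real.toNNReal (x ^ 2))) = x • quantileL2 (gaussianP2 1) := by
  unfold quantileL2
  rw [← MemLp.toLp_const_smul, MemLp.toLp_eq_toLp_iff]
  have : ∀ᵐ u ∂unif, u ∈ Ioo (0 : ℝ) 1 := ae_restrict_mem measurableSet_Ioo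
  filter_upwards [this] with u hu
  simp only [gaussianP2, gaussianReal_sq_eq_map, Pi.smul_apply, smul_eq_mul]
  exact quantile_map_const_mul _ hx hu

theorem quantileL2_eq_smul_iff {μ : P2} {x : ℝ} (hx : 0 < x) :
    quantileL2 μ = x • quantileL2 (gaussianP2 1) ↔
      μ.1 = gaussianReal 0 (Real.toNNReal (x ^ 2)) := by
  rw [← quantileL2_gaussianP2 hx]
  exact ⟨P2.ext_of_quantileL2, fun h => congrArg quantileL2 (Subtype.ext h)⟩

end Quantiles

/-! ### Existence, uniqueness and non-coincidence for E-splines -/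

section ESplines

variable {N : ℕ} {τ : Fin (N + 1) → ℝ}

/-- Positivity keeps the ambient Hilbert-space minimizer inside the image of `P2`, so restricting
the competitors changes neither the minimum nor its uniqueness. -/
theorem isESpline_iff (hτ : StrictMono τ) (hτ0 : τ 0 = 0) (hτ1 : τ (Fin.last N) = 1)
    {x c : Fin (N + 1) → ℝ} {α β : ℝ} (hc : ∑ i, c i = 0) (hcτ : ∑ i, c i * τ i = 0)
    (hx : ∀ i, cubicSpline τ c α β (τ i) = x i)
    (hpos : ∀ t ∈ Icc (0 : ℝ) 1, 0 < cubicSpline τ c α β t) {ν : Fin (N + 1) → Measure ℝ}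
    (hν : ∀ i, ν i = gaussianReal 0 (Real.toNNReal (x i ^ 2))) (μ : ℝ → P2) :
    IsESpline τ ν μ ↔ ∀ t ∈ Icc (0 : ℝ) 1,
      (μ t).1 = gaussianReal 0 (Real.toNNReal (cubicSpline τ c α β t ^ 2)) := by
  have hk := knot_mem_Icc hτ hτ0 hτ1
  obtain ⟨E, hE, hle, hge⟩ := exists_splineEnergy_cubicSpline_smul hτ hτ0 hτ1 (α := α) (β := β)
    hc hcτ (quantileL2 (gaussianP2 1))
  have hgap : ∀ μ' : ℝ → P2, (∀ i, (μ' (τ i)).1 = ν i) → ∀ t ∈ Icc (0 : ℝ) 1,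
      ENNReal.ofReal (E + 16 * ‖quantileL2 (μ' t) -
        cubicSpline τ c α β t • quantileL2 (gaussianP2 1)‖ ^ 2) ≤ eCost μ' :=
    fun μ' h => hge _ fun i =>
      (quantileL2_eq_smul_iff (hpos _ (hk i))).2 (by rw [h, hν, ← hx])
  have hcost : ∀ μ' : ℝ → P2, (∀ t ∈ Icc (0 : ℝ) 1,
      (μ' t).1 = gaussianReal 0 (Real.toNNReal (cubicSpline τ c α β t ^ 2))) →
      eCost μ' ≤ ENNReal.ofReal E :=
    fun μ' h => hle _ fun t ht => (quantileL2_eq_smul_iff (hpos t ht)).2 (h t ht)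
  have hinterp : ∀ μ' : ℝ → P2, (∀ t ∈ Icc (0 : ℝ) 1,
      (μ' t).1 = gaussianReal 0 (Real.toNNReal (cubicSpline τ c α β t ^ 2))) →
      ∀ i, (μ' (τ i)).1 = ν i :=
    fun μ' h i => by rw [h _ (hk i), hx, hν]
  constructor
  · rintro ⟨hi, hmin⟩ t ht
    let μ' : ℝ → P2 := fun t => gaussianP2 (Real.toNNReal (cubicSpline τ c α β t ^ 2))
    have h := (hgap μ hi t ht).trans
      ((hmin μ' (hinterp μ' fun _ _ => rfl)).trans (hcost μ' fun _ _ => rfl))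
    rw [ENNReal.ofReal_le_ofReal_iff hE] at h
    rw [← quantileL2_eq_smul_iff (hpos t ht), ← sub_eq_zero, ← norm_eq_zero, ← sq_eq_zero_iff]
    exact le_antisymm (by linarith) (sq_nonneg _)
  · intro h
    refine ⟨hinterp μ h, fun μ' h' => (hcost μ h).trans (le_trans ?_
      (hgap μ' h' 0 (by simp)))⟩
    exact ENNReal.ofReal_le_ofReal (le_add_of_nonneg_right (by positivity))

/-- The standard deviation `√((1 - t)² + t²)` is not piecewise polynomial. -/
theorem IsNaturalCubicSpline.exists_sq_ne {x : Fin (N + 1) → ℝ} {γ : ℝ → ℝ}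
    (h : IsNaturalCubicSpline τ x γ) (hN : N ≠ 0) (hτ : StrictMono τ) (hτ0 : τ 0 = 0)
    (hτ1 : τ (Fin.last N) = 1) :
    ∃ t ∈ Icc (0 : ℝ) 1, γ t ^ 2 ≠ (1 - t) ^ 2 + t ^ 2 := by
  by_contra! hne
  obtain ⟨n, rfl⟩ := Nat.exists_eq_succ_of_ne_zero hN
  obtain ⟨p, -, hp⟩ := h.piecewise_cubic 0
  have hk := knot_mem_Icc hτ hτ0 hτ1
  have hlt : τ (Fin.castSucc 0) < τ (Fin.succ 0) := hτ (Fin.castSucc_lt_succ)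
  -- Agreement on the first knot interval, an infinite set, is an identity of polynomials. It forces
  -- `p = a X + b` with `a² = 2`, `b² = 1`, `a b = -1`, which is absurd.
  have heq : p ^ 2 = (1 - Polynomial.X) ^ 2 + Polynomial.X ^ 2 := by
    refine Polynomial.eq_of_infinite_eval_eq _ _ ((Icc_infinite hlt).mono fun t ht => ?_)
    have := hne t ⟨(hk _).1.trans ht.1, ht.2.trans (hk _).2⟩
    rw [hp t ht] at this
    simpa using this
  have hdeg : p.natDegree ≤ 1 := by
    have h2 : (p ^ 2).natDegree ≤ 2 := by rw [heq]; compute_degree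
    rw [Polynomial.natDegree_pow] at h2
    lia
  obtain ⟨a, b, rfl⟩ := Polynomial.exists_eq_X_add_C_of_natDegree_le_one hdeg
  have e0 := congrArg (Polynomial.eval 0) heq
  have e1 := congrArg (Polynomial.eval 1) heq
  have e2 := congrArg (Polynomial.eval (-1)) heq
  simp only [Polynomial.eval_pow, Polynomial.eval_add, Polynomial.eval_mul, Polynomial.eval_C,
    Polynomial.eval_X, Polynomial.eval_sub, Polynomial.eval_one] at e0 e1 e2
  have hab : a * b = -1 := by linarith
  have ha : a ^ 2 = 2 := by linarith
  have hb : b ^ 2 = 1 := by linarith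
  have := mul_pow a b 2
  rw [hab, ha, hb] at this
  norm_num at this

end ESplines

/-! ### P-splines: zero cost and second moments -/

section PSplines

variable {N : ℕ} {τ : Fin (N + 1) → ℝ} {ν : Fin (N + 1) → Measure ℝ}

theorem map_affine_prod_gaussianReal (t : ℝ) :
    ((gaussianReal 0 1).prod (gaussianReal 0 1)).map (fun p => (1 - t) * p.1 + t * p.2) =
      gaussianReal 0 (Real.toNNReal ((1 - t) ^ 2 + t ^ 2)) := by
  have hind : IndepFun (fun p : ℝ × ℝ => (1 - t) * p.1) (fun p : ℝ × ℝ => t * p.2)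
      ((gaussianReal 0 1).prod (gaussianReal 0 1)) :=
    indepFun_prod (X := fun x : ℝ => (1 - t) * x) (Y := fun x : ℝ => t * x)
      (by fun_prop) (by fun_prop)
  have h := gaussianReal_add_gaussianReal_of_indepFun hind
    (m₁ := 0) (m₂ := 0) (v₁ := Real.toNNReal ((1 - t) ^ 2)) (v₂ := Real.toNNReal (t ^ 2))
    (by
      rw [gaussianReal_sq_eq_map]
      conv_rhs => rw [← (measurePreserving_fst (μ := gaussianReal 0 1)
        (ν := gaussianReal 0 1)).map_eq, Measure.map_map (by fun_prop) (by fun_prop)]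
      rfl)
    (by
      rw [gaussianReal_sq_eq_map]
      conv_rhs => rw [← (measurePreserving_snd (μ := gaussianReal 0 1)
        (ν := gaussianReal 0 1)).map_eq, Measure.map_map (by fun_prop) (by fun_prop)]
      rfl)
  rw [← Real.toNNReal_add (sq_nonneg _) (sq_nonneg _), add_zero] at h
  exact h

/-- A process with affine paths and Gaussian marginals interpolates at zero cost. -/
theorem exists_interpolatingProcess_pCost_eq_zero (τ : Fin (N + 1) → ℝ)
    (hν : ∀ i, ν i = gaussianReal 0 (Real.toNNReal ((1 - τ i) ^ 2 + τ i ^ 2))) :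
    ∃ (Ω : Type u) (_ : MeasurableSpace Ω) (P : Measure Ω) (_ : IsProbabilityMeasure P)
      (X : ℝ → Ω → ℝ), IsInterpolatingProcess τ ν P X ∧ pCost P X = 0 ∧
        ∀ t, P.map (X t) = gaussianReal 0 (Real.toNNReal ((1 - t) ^ 2 + t ^ 2)) := by
  let Q := (gaussianReal 0 1).prod (gaussianReal 0 1)
  -- `ULift` moves the Gaussian plane into the universe over which P-splines compete.
  let X : ℝ → ULift.{u} (ℝ × ℝ) → ℝ := fun t ω => (1 - t) * ω.down.1 + t * ω.down.2
  have hup : Measurable (ULift.up : ℝ × ℝ → ULift.{u} (ℝ × ℝ)) := measurable_up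
  have hdown : Measurable (ULift.down : ULift.{u} (ℝ × ℝ) → ℝ × ℝ) := measurable_down
  have hX : ∀ t, Measurable (X t) := fun t => by fun_prop
  have hlaw : ∀ t, (Q.map ULift.up).map (X t) =
      gaussianReal 0 (Real.toNNReal ((1 - t) ^ 2 + t ^ 2)) := fun t => by
    rw [Measure.map_map (hX t) hup]
    exact map_affine_prod_gaussianReal t
  have hpath : ∀ ω, (fun t => X t ω) = fun t => ω.down.1 + t • (ω.down.2 - ω.down.1) := by
    intro ω; ext t; simp only [X, smul_eq_mul]; ring
  refine ⟨ULift.{u} (ℝ × ℝ), inferInstance, Q.map ULift.up,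
    Measure.isProbabilityMeasure_map hup.aemeasurable, X,
    ⟨fun t _ => hX t, ae_of_all _ fun ω => ⟨fun _ => 0, ?_⟩, fun i => by rw [hlaw, hν]⟩, ?_, hlaw⟩
  · rw [hpath]
    exact hasL2Acceleration_affine _ _
  · simp only [pCost, hpath, splineEnergy_affine, lintegral_zero]

/-- A process of zero cost is almost surely affine. -/
theorem ae_eq_chord_of_pCost_eq_zero {Ω : Type u} [MeasurableSpace Ω] {P : Measure Ω}
    {X : ℝ → Ω → ℝ} (hX : ∀ t ∈ Icc (0 : ℝ) 1, Measurable (X t)) (h : pCost P X = 0) {t : ℝ}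
    (ht : t ∈ Icc (0 : ℝ) 1) : X t =ᵐ[P] fun ω => (1 - t) * X 0 ω + t * X 1 ω := by
  have m0 := hX 0 (by simp)
  have m1 := hX 1 (by simp)
  have mt := hX t ht
  have hle : ∫⁻ ω, ENNReal.ofReal (16 * ‖X t ω - (1 - t) • X 0 ω - t • X 1 ω‖ ^ 2) ∂P = 0 :=
    le_antisymm (h ▸ lintegral_mono fun ω => sq_norm_sub_chord_le_splineEnergy
      (γ := fun t => X t ω) ht) zero_le
  rw [lintegral_eq_zero_iff (by fun_prop)] at hle
  filter_upwards [hle] with ω hω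
  rw [Pi.zero_apply, ENNReal.ofReal_eq_zero] at hω
  have : ‖X t ω - (1 - t) • X 0 ω - t • X 1 ω‖ ^ 2 = 0 := le_antisymm (by linarith) (sq_nonneg _)
  rw [sq_eq_zero_iff, norm_eq_zero, smul_eq_mul, smul_eq_mul] at this
  linarith

theorem moments_of_map_eq_gaussianReal {Ω : Type*} [MeasurableSpace Ω] {P : Measure Ω}
    {X : Ω → ℝ} (hX : AEMeasurable X P) {v : ℝ≥0} (h : P.map X = gaussianReal 0 v) :
    MemLp X 2 P ∧ ∫ ω, X ω ∂P = 0 ∧ variance X P = v := by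
  have hid : MemLp id 2 (P.map X) := h ▸ memLp_id_gaussianReal' 2 (by simp)
  refine ⟨(memLp_map_measure_iff hid.1 hX).1 hid, ?_, ?_⟩
  · have := integral_map hX (f := fun x : ℝ => x) (by fun_prop)
    rw [← this, h, integral_id_gaussianReal]
  · rw [← variance_id_map hX, h, variance_id_gaussianReal]

/-- The endpoints of a P-spline are uncorrelated, because the variance is prescribed at an interior
knot; this determines the first two moments at all times. -/
theorem IsPSpline.moments {Ω : Type u} [MeasurableSpace Ω] {P : Measure Ω}
    [IsProbabilityMeasure P] {X : ℝ → Ω → ℝ} (h : IsPSpline τ ν P X) (hN : 2 ≤ N)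
    (hτ : StrictMono τ) (hτ0 : τ 0 = 0) (hτ1 : τ (Fin.last N) = 1)
    (hν : ∀ i, ν i = gaussianReal 0 (Real.toNNReal ((1 - τ i) ^ 2 + τ i ^ 2))) {t : ℝ}
    (ht : t ∈ Icc (0 : ℝ) 1) :
    MemLp (X t) 2 P ∧ ∫ ω, X t ω ∂P = 0 ∧ variance (X t) P = (1 - t) ^ 2 + t ^ 2 := by
  obtain ⟨hX, hmin⟩ := h
  have hk := knot_mem_Icc hτ hτ0 hτ1
  have hcost : pCost P X = 0 := by
    obtain ⟨Ω', _, P', _, X', hX', h0, -⟩ := exists_interpolatingProcess_pCost_eq_zero.{u} τ hν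
    exact le_antisymm (h0 ▸ hmin Ω' P' X' hX') zero_le
  have hchord := fun t ht => ae_eq_chord_of_pCost_eq_zero hX.measurable hcost (t := t) ht
  have hknot : ∀ i, MemLp (X (τ i)) 2 P ∧ ∫ ω, X (τ i) ω ∂P = 0 ∧
      variance (X (τ i)) P = (1 - τ i) ^ 2 + τ i ^ 2 := by
    intro i
    have := moments_of_map_eq_gaussianReal (hX.measurable _ (hk i)).aemeasurable
      ((hX.law i).trans (hν i))
    rwa [Real.coe_toNNReal _ (sq_add_sq_pos _).le] at this
  obtain ⟨L0, M0, V0⟩ := hτ0 ▸ hknot 0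
  obtain ⟨L1, M1, V1⟩ := hτ1 ▸ hknot (Fin.last N)
  have hvar : ∀ s ∈ Icc (0 : ℝ) 1, variance (X s) P =
      (1 - s) ^ 2 + s ^ 2 + 2 * (s * (1 - s)) * covariance (X 0) (X 1) P := by
    intro s hs
    rw [variance_congr (hchord s hs), variance_fun_add (L0.const_mul _) (L1.const_mul _),
      variance_const_mul, variance_const_mul, covariance_const_mul_left,
      covariance_const_mul_right, V0, V1]
    ring
  have hcov : covariance (X 0) (X 1) P = 0 := by
    -- Since `2 ≤ N`, the knot with index `1` is interior, so the factor `s (1 - s)` of the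
    -- covariance is nonzero there.
    have hi : (⟨1, by lia⟩ : Fin (N + 1)) ≠ 0 := by simp [Fin.ext_iff]
    have h0 : τ 0 < τ ⟨1, by lia⟩ := hτ (Fin.pos_of_ne_zero hi)
    have h1 : τ ⟨1, by lia⟩ < τ (Fin.last N) := hτ (Fin.lt_def.2 (by simp; lia))
    rw [hτ0] at h0
    rw [hτ1] at h1
    have := (hknot ⟨1, by lia⟩).2.2
    rw [hvar _ (hk _)] at this
    have hp := mul_pos h0 (sub_pos.2 h1)
    have hz : 2 * (τ ⟨1, by lia⟩ * (1 - τ ⟨1, by lia⟩)) * covariance (X 0) (X 1) P = 0 := by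
      linarith
    exact (mul_eq_zero.1 hz).resolve_left (by positivity)
  refine ⟨((L0.const_mul (1 - t)).add (L1.const_mul t)).ae_eq (hchord t ht).symm, ?_, ?_⟩
  · rw [integral_congr_ae (hchord t ht), integral_add ((L0.integrable one_le_two).const_mul _)
      ((L1.integrable one_le_two).const_mul _), integral_const_mul, integral_const_mul, M0, M1]
    simp
  · rw [hvar t ht, hcov, mul_zero, add_zero]

end PSplines
end WassersteinSplines

/-! ### The comparison of E-splines and P-splines -/

theorem proposition2 (N : ℕ) (hN : 2 ≤ N) (τ : Fin (N + 1) → ℝ) (hτ : StrictMono τ)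
    (hτ0 : τ 0 = 0) (hτ1 : τ (Fin.last N) = 1)
    (ν : Fin (N + 1) → Measure ℝ)
    (hν : ∀ i, ν i = gaussianReal 0 (Real.toNNReal ((1 - τ i) ^ 2 + τ i ^ 2))) :
    -- The E-spline exists, is unique and is Gaussian; its standard deviation is the positive
    -- natural cubic spline through the standard deviations of the data.
    (∃ γ : ℝ → ℝ,
      WassersteinSplines.IsNaturalCubicSpline τ (fun i => √((1 - τ i) ^ 2 + τ i ^ 2)) γ ∧
      (∀ t ∈ Icc (0 : ℝ) 1, 0 < γ t) ∧
      ∀ μ : ℝ → WassersteinSplines.P2, WassersteinSplines.IsESpline τ ν μ ↔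
        ∀ t ∈ Icc (0 : ℝ) 1, (μ t).1 = gaussianReal 0 (Real.toNNReal (γ t ^ 2))) ∧
    -- There is a P-spline with Gaussian marginals.
    (∃ (Ω : Type u) (_ : MeasurableSpace Ω) (P : Measure Ω) (_ : IsProbabilityMeasure P)
      (X : ℝ → Ω → ℝ), WassersteinSplines.IsPSpline τ ν P X ∧
        ∀ t ∈ Icc (0 : ℝ) 1,
          P.map (X t) = gaussianReal 0 (Real.toNNReal ((1 - t) ^ 2 + t ^ 2))) ∧
    -- Every P-spline is centered, with standard deviation `√((1 - t)² + t²)`.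
    (∀ (Ω : Type u) [MeasurableSpace Ω] (P : Measure Ω) [IsProbabilityMeasure P]
      (X : ℝ → Ω → ℝ), WassersteinSplines.IsPSpline τ ν P X →
        ∀ t ∈ Icc (0 : ℝ) 1, MemLp (X t) 2 P ∧ ∫ ω, X t ω ∂P = 0 ∧
          √(variance (X t) P) = √((1 - t) ^ 2 + t ^ 2)) ∧
    -- The measures interpolated by the E-spline and by a P-spline do not coincide.
    (∀ μ : ℝ → WassersteinSplines.P2, WassersteinSplines.IsESpline τ ν μ →
      ∀ (Ω : Type u) [MeasurableSpace Ω] (P : Measure Ω) [IsProbabilityMeasure P]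
        (X : ℝ → Ω → ℝ), WassersteinSplines.IsPSpline τ ν P X →
          ∃ t ∈ Icc (0 : ℝ) 1, (μ t).1 ≠ P.map (X t)) := by
  have hν' : ∀ i, ν i = gaussianReal 0 (Real.toNNReal (√((1 - τ i) ^ 2 + τ i ^ 2) ^ 2)) :=
    fun i => by rw [hν, Real.sq_sqrt (WassersteinSplines.sq_add_sq_pos _).le]
  obtain ⟨c, α, β, hc, hcτ, hx⟩ := WassersteinSplines.exists_cubicSpline_eq hτ hτ0 hτ1
    fun i => √((1 - τ i) ^ 2 + τ i ^ 2)
  have hnat := WassersteinSplines.isNaturalCubicSpline_cubicSpline hτ hτ0 hτ1 hc hcτ hx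
  have hpos := fun t ht => WassersteinSplines.cubicSpline_pos hτ hτ0 hτ1 hc hcτ hx (t := t) ht
  have hE := WassersteinSplines.isESpline_iff hτ hτ0 hτ1 hc hcτ hx hpos hν'
  refine ⟨⟨_, hnat, hpos, hE⟩, ?_, fun Ω _ P _ X hX t ht => ?_, fun μ hμ Ω _ P _ X hX => ?_⟩
  · obtain ⟨Ω, m, P, hP, X, hX, h0, hlaw⟩ :=
      WassersteinSplines.exists_interpolatingProcess_pCost_eq_zero.{u} τ hν
    exact ⟨Ω, m, P, hP, X, ⟨hX, fun _ _ _ _ _ _ => h0 ▸ zero_le⟩, fun t _ => hlaw t⟩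
  · obtain ⟨h1, h2, h3⟩ := hX.moments hN hτ hτ0 hτ1 hν ht
    exact ⟨h1, h2, by rw [h3]⟩
  · obtain ⟨t, ht, hne⟩ := hnat.exists_sq_ne (by lia) hτ hτ0 hτ1
    refine ⟨t, ht, fun heq => hne ?_⟩
    rw [(hE μ).1 hμ t ht] at heq
    have hvar := (WassersteinSplines.moments_of_map_eq_gaussianReal
      (hX.1.measurable t ht).aemeasurable heq.symm).2.2
    rw [(hX.moments hN hτ hτ0 hτ1 hν ht).2.2, Real.coe_toNNReal _ (sq_nonneg _)] at hvar
    exact hvar.symm
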